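/- For a Hausdorff space $X$, let $CL(X)$ be the set of all nonempty closed subsets of $X$ with the Fell topology $\tau_F$, i.e. the topology generated by the subbase consisting of the sets $\{A\in CL(X): A\cap U\neq\emptyset\}$ with $U\subset X$ nonempty open, and the sets $\{A\in CL(X): A\cap K=\emptyset\}$ with $K\subset X$ compact, $K\ne X$. Let $\mathcal K(X)$, $\mathcal F(X)$ and $\mathcal F_2(X)$ be the subspaces of $(CL(X),\tau_F)$ consisting of the nonempty compact subsets, the nonempty finite subsets, and the nonempty subsets with at most two points, respectively. A topological space $Y$ is quasi-metrizable if there is a function $d:Y\times Y\to[0,\infty)$ with $d(x,y)=0$ if and only if $x=y$, and $d(x,z)\le d(x,y)+d(y,z)$ for all $x,y,z\in Y$, such that the balls $\{y\in Y: d(x,y)<\varepsilon\}$ ($x\in Y$, $\varepsilon>0$) form a base of the topology of $Y$. The space $X$ is hemicompact if there are compact sets $K_1,K_2,\ldots\subset X$ such that every compact subset of $X$ is contained in some $K_n$. For every Hausdorff space $X$ the following statements are equivalent: 1. $(CL(X),\tau_F)$ is metrizable; 2. $(CL(X),\tau_F)$ is quasi-metrizable; 3. $(\mathcal K(X),\tau_F)$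 is quasi-metrizable; 4. $(\mathcal F(X),\tau_F)$ is quasi-metrizable; 5. $(\mathcal F_2(X),\tau_F)$ is quasi-metrizable; 6. $X$ is hemicompact and metrizable. -/

import Mathlib

/-- A quasi-metric: a nonnegative real function satisfying all the axioms of a metric
except possibly symmetry. -/
structure IsQuasiMetric {Y : Type*} (d : Y → Y → ℝ) : Prop where
  nonneg : ∀ x y, 0 ≤ d x y
  eq_zero_iff : ∀ x y, d x y = 0 ↔ x = y
  triangle : ∀ x y z, d x z ≤ d x y + d y z

/-- `Y` is quasi-metrizable: for some quasi-metric `d` on `Y`, the balls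
`B(x, ε) = {y | d x y < ε}` with `ε > 0` form a base of the topology of `Y`. -/
def QuasiMetrizableSpace (Y : Type*) [TopologicalSpace Y] : Prop :=
  ∃ d : Y → Y → ℝ, IsQuasiMetric d ∧
    TopologicalSpace.IsTopologicalBasis
      {B : Set Y | ∃ (x : Y) (ε : ℝ), 0 < ε ∧ B = {y | d x y < ε}}

/-- `X` is hemicompact: the compact subsets of `X`, ordered by inclusion, have a countable
cofinal subfamily. -/
def HemicompactSpace (X : Type*) [TopologicalSpace X] : Prop :=
  ∃ K : ℕ → Set X, (∀ n, IsCompact (K n)) ∧ ∀ L : Set X, IsCompact L → ∃ n, L ⊆ K n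

/-- The hyperspace `CL(X)` of all nonempty closed subsets of `X`. -/
@[ext]
structure CL (X : Type*) [TopologicalSpace X] where
  carrier : Set X
  nonempty : carrier.Nonempty
  isClosed : IsClosed carrier

namespace CL

/-- `U⁻`, the closed sets that meet `U`. -/
def hit {X : Type*} [TopologicalSpace X] (U : Set X) : Set (CL X) :=
  {A | (A.carrier ∩ U).Nonempty}

/-- `V⁺`, the closed sets that are contained in `V`. -/
def inside {X : Type*} [TopologicalSpace X] (V : Set X) : Set (CL X) :=
  {A | A.carrier ⊆ V}

/-- The Fell topology on `CL(X)`, generated by the sets `U⁻` with `U` nonempty and open and the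
sets `(Kᶜ)⁺` with `K` compact and `K ≠ X`. -/
instance fellTopology (X : Type*) [TopologicalSpace X] : TopologicalSpace (CL X) :=
  TopologicalSpace.generateFrom
    ({S | ∃ U : Set X, IsOpen U ∧ U.Nonempty ∧ S = hit U} ∪
      {S | ∃ K : Set X, IsCompact K ∧ K ≠ Set.univ ∧ S = inside Kᶜ})

/-- `𝒦(X)`, the nonempty compact subsets of `X` as a subspace of `CL(X)`
(in a Hausdorff space every compact set is closed). -/
def compacts (X : Type*) [TopologicalSpace X] : Set (CL X) :=
  {A | IsCompact A.carrier}

/-- `ℱ(X)`, the nonempty finite subsets of `X` as a subspace of `CL(X)`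
(in a Hausdorff space every finite set is closed). -/
def finites (X : Type*) [TopologicalSpace X] : Set (CL X) :=
  {A | A.carrier.Finite}

/-- `ℱₙ(X)`, the nonempty subsets of `X` with at most `n` points as a subspace of `CL(X)`
(in a Hausdorff space every finite set is closed). -/
def finitesLE (X : Type*) [TopologicalSpace X] (n : ℕ) : Set (CL X) :=
  {A | A.carrier.encard ≤ n}

end CL

/-! Quasi-metrizability passes to subspaces, so the content is 5 → 6 and 6 → 1.

For 5 → 6, a Fell neighbourhood of `{x}` restricts the second point of `{x, y}` only through a
compact set missing `x`. Hence a countable base at `{x}` yields countably many compact sets cofinal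
among those missing `x`, and two such points give hemicompactness; Arens' theorem gives local
compactness. Compact sets in a quasi-metrizable space are `Gδ`; pulling the singletons of a compact
`K` back along `(x, y) ↦ {x, y}` makes the diagonal of `K` a `Gδ`, so `K` is metrizable by Šneĭder.
Then `X` is second countable and regular.

For 6 → 1, `X` is locally compact and second countable, which makes `CL X` regular, T0 and second
countable; Urysohn's theorem applies. -/

open Set Filter Topology

/-! ### Quasi-metrizable spaces -/

section QuasiMetric

variable {Y Z : Type*} [TopologicalSpace Y] [TopologicalSpace Z]

/-- Quasi-metrizability in terms of neighbourhood bases of balls. -/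
theorem quasiMetrizableSpace_iff_hasBasis :
    QuasiMetrizableSpace Y ↔ ∃ d : Y → Y → ℝ, IsQuasiMetric d ∧
      ∀ x, (𝓝 x).HasBasis (fun ε : ℝ => 0 < ε) (fun ε => {y | d x y < ε}) := by
  constructor
  · rintro ⟨d, hd, hb⟩
    refine ⟨d, hd, fun x => ⟨fun t => ?_⟩⟩
    have hself : d x x = 0 := (hd.eq_zero_iff x x).2 rfl
    constructor
    · intro ht
      obtain ⟨_, ⟨z, ε, hε, rfl⟩, hx, hsub⟩ := hb.mem_nhds_iff.1 ht
      refine ⟨ε - d z x, sub_pos.2 hx, fun y hy => hsub ?_⟩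
      have := hd.triangle z x y
      simp only [mem_ofPred_eq] at hy ⊢
      linarith
    · rintro ⟨ε, hε, hsub⟩
      exact mem_of_superset ((hb.isOpen ⟨x, ε, hε, rfl⟩).mem_nhds (by simpa [hself])) hsub
  · rintro ⟨d, hd, hb⟩
    refine ⟨d, hd, TopologicalSpace.isTopologicalBasis_of_isOpen_of_nhds ?_ ?_⟩
    · rintro _ ⟨x, ε, hε, rfl⟩
      refine isOpen_iff_mem_nhds.2 fun y hy => (hb y).mem_iff.2
        ⟨ε - d x y, sub_pos.2 hy, fun z hz => ?_⟩
      have := hd.triangle x y z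
      simp only [mem_ofPred_eq] at hz ⊢
      linarith
    · intro a u ha hu
      obtain ⟨ε, hε, hsub⟩ := (hb a).mem_iff.1 (hu.mem_nhds ha)
      exact ⟨_, ⟨a, ε, hε, rfl⟩, by simpa [(hd.eq_zero_iff a a).2 rfl], hsub⟩

theorem Topology.IsEmbedding.quasiMetrizableSpace {f : Y → Z} (hf : IsEmbedding f)
    (h : QuasiMetrizableSpace Z) : QuasiMetrizableSpace Y := by
  obtain ⟨d, hd, hb⟩ := quasiMetrizableSpace_iff_hasBasis.1 h
  refine quasiMetrizableSpace_iff_hasBasis.2 ⟨fun x y => d (f x) (f y),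
    ⟨fun x y => hd.nonneg _ _, fun x y => (hd.eq_zero_iff _ _).trans hf.injective.eq_iff,
      fun x y z => hd.triangle _ _ _⟩, fun x => ?_⟩
  rw [hf.nhds_eq_comap]
  exact (hb (f x)).comap f

theorem TopologicalSpace.MetrizableSpace.quasiMetrizableSpace
    [TopologicalSpace.MetrizableSpace Y] : QuasiMetrizableSpace Y := by
  let := TopologicalSpace.metrizableSpaceMetric Y
  refine quasiMetrizableSpace_iff_hasBasis.2 ⟨fun x y => dist x y,
    ⟨fun x y => dist_nonneg, fun x y => dist_eq_zero, fun x y z => dist_triangle x y z⟩,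
    fun x => ?_⟩
  convert Metric.nhds_basis_ball (x := x) using 2
  ext y
  simp [dist_comm]

theorem QuasiMetrizableSpace.firstCountableTopology (h : QuasiMetrizableSpace Y) :
    FirstCountableTopology Y := by
  obtain ⟨d, -, hb⟩ := quasiMetrizableSpace_iff_hasBasis.1 h
  refine ⟨fun x => HasBasis.isCountablyGenerated (ι := ℕ) (p := fun _ => True)
    (s := fun n : ℕ => {y | d x y < 1 / ((n : ℝ) + 1)}) ?_⟩
  refine (hb x).to_hasBasis (fun ε hε => ?_)
    (fun n _ => ⟨1 / ((n : ℝ) + 1), by positivity, Subset.rfl⟩)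
  obtain ⟨n, hn⟩ := exists_nat_one_div_lt hε
  exact ⟨n, trivial, fun y (hy : d x y < _) => hy.trans hn⟩

/-- Compact subsets of a quasi-metrizable space are `Gδ` sets. -/
theorem IsCompact.isGδ_of_quasiMetrizableSpace (h : QuasiMetrizableSpace Y) {C : Set Y}
    (hC : IsCompact C) : IsGδ C := by
  obtain ⟨d, hd, hb⟩ := quasiMetrizableSpace_iff_hasBasis.1 h
  have hW : C = ⋂ n : ℕ, ⋃ x ∈ C, interior {y | d x y < 1 / ((n : ℝ) + 1)} := by
    apply Subset.antisymm
    · intro x hx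
      refine mem_iInter.2 fun n => mem_biUnion hx ?_
      exact mem_interior_iff_mem_nhds.2 ((hb x).mem_of_mem (by positivity))
    · intro y hy
      have hex : ∀ n : ℕ, ∃ x ∈ C, d x y < 1 / ((n : ℝ) + 1) := fun n => by
        obtain ⟨x, hx, hxy⟩ := mem_iUnion₂.1 (mem_iInter.1 hy n)
        exact ⟨x, hx, interior_subset (s := {y | d x y < 1 / ((n : ℝ) + 1)}) hxy⟩
      choose u huC hu using hex
      -- The centres `u n` cluster at some `x ∈ C`. Then `d x (u n)` and `d (u n) y` are small
      -- together, in the order the triangle inequality needs without symmetry.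
      obtain ⟨x, hx, hclu⟩ := hC.exists_mapClusterPt (f := atTop) (u := u)
        (tendsto_principal.2 (Eventually.of_forall huC))
      have hle : d x y ≤ 0 := by
        refine le_of_forall_pos_lt_add fun ε hε => ?_
        have h1 : ∃ᶠ n in atTop, d x (u n) < ε / 2 :=
          hclu.frequently ((hb x).mem_of_mem (half_pos hε))
        have h2 : ∀ᶠ n : ℕ in atTop, 1 / ((n : ℝ) + 1) < ε / 2 :=
          tendsto_one_div_add_atTop_nhds_zero_nat.eventually (gt_mem_nhds (half_pos hε))
        obtain ⟨n, hn1, hn2⟩ := (h1.and_eventually h2).exists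
        have := hd.triangle x (u n) y
        have := hu n
        linarith
      rwa [← (hd.eq_zero_iff x y).1 (le_antisymm hle (hd.nonneg x y))]
  rw [hW]
  exact IsGδ.iInter_of_isOpen fun n => isOpen_biUnion fun x _ => isOpen_interior

end QuasiMetric

/-- **Šneĭder's theorem**: a compact Hausdorff space with a `Gδ` diagonal is metrizable. -/
theorem metrizableSpace_of_isGδ_diagonal {K : Type*} [TopologicalSpace K] [CompactSpace K]
    [T2Space K] (h : IsGδ (diagonal K)) : TopologicalSpace.MetrizableSpace K := by
  let : UniformSpace K := uniformSpaceOfCompactR1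
  obtain ⟨W, hWo, hW⟩ := isGδ_iff_eq_iInter_nat.1 h
  have hex : ∀ n, ∃ V : Set (K × K), IsOpen V ∧ diagonal K ⊆ V ∧ closure V ⊆ W n := fun n =>
    normal_exists_closure_subset isClosed_diagonal (hWo n) (hW.subset.trans (iInter_subset _ n))
  choose V hVo hVd hVW using hex
  -- The sets `⋂ i ≤ n, closure (V i)` are compact and decrease to the diagonal, so they are
  -- eventually inside each of its neighbourhoods, which are the entourages.
  have hcg : (uniformity K).IsCountablyGenerated := by
    refine HasBasis.isCountablyGenerated (ι := ℕ) (p := fun _ => True)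
      (s := fun n : ℕ => ⋂ i ≤ n, closure (V i)) ⟨fun t => ?_⟩
    rw [← nhdsSet_diagonal_eq_uniformity]
    have hclosed : ∀ n : ℕ, IsClosed (⋂ i ≤ n, closure (V i)) := fun n =>
      isClosed_biInter fun i _ => isClosed_closure
    constructor
    · intro ht
      have hnhds : ∀ x ∈ ⋂ n : ℕ, ⋂ i ≤ n, closure (V i), t ∈ 𝓝 x := fun x hx => by
        refine mem_nhdsSet_iff_forall.1 ht x ?_
        rw [hW]
        exact mem_iInter.2 fun n => hVW n (mem_iInter₂.1 (mem_iInter.1 hx n) n le_rfl)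
      obtain ⟨n, hn⟩ := exists_subset_nhds_of_isCompact
        (directed_of_isDirected_le fun m n hmn =>
          biInter_subset_biInter_left fun i hi => le_trans hi hmn)
        (fun n => (hclosed n).isCompact) hnhds
      exact ⟨n, trivial, hn⟩
    · rintro ⟨n, -, hn⟩
      refine mem_of_superset ((biInter_mem (finite_Iic n)).2 fun i _ => ?_) hn
      exact mem_of_superset ((hVo i).mem_nhdsSet.2 (hVd i)) subset_closure
  infer_instance

/-! ### Hemicompact spaces -/

section Hemicompact

variable {X : Type*} [TopologicalSpace X]

theorem HemicompactSpace.sigmaCompactSpace (h : HemicompactSpace X) : SigmaCompactSpace X := by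
  obtain ⟨K, hK, hsub⟩ := h
  refine ⟨⟨K, hK, eq_univ_of_forall fun x => ?_⟩⟩
  obtain ⟨n, hn⟩ := hsub {x} isCompact_singleton
  exact mem_iUnion.2 ⟨n, hn rfl⟩

/-- **Arens' theorem**: a first countable hemicompact Hausdorff space is locally compact. -/
theorem HemicompactSpace.locallyCompactSpace [T2Space X] [FirstCountableTopology X]
    (h : HemicompactSpace X) : LocallyCompactSpace X := by
  obtain ⟨K, hK, hsub⟩ := h
  suffices WeaklyLocallyCompactSpace X by infer_instance
  refine ⟨fun x => ?_⟩
  by_contra! hx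
  obtain ⟨U, hU⟩ := (𝓝 x).exists_antitone_basis
  -- The points `y n` converge to `x`, so together with `x` they form a compact set contained in no
  -- `K m`.
  have hex : ∀ n, ∃ y ∈ U n, y ∉ K n := fun n =>
    not_subset.1 fun hle => hx (K n) (hK n) (mem_of_superset (hU.mem n) hle)
  choose y hyU hyK using hex
  obtain ⟨m, hm⟩ := hsub _ (hU.tendsto hyU).isCompact_insert_range
  exact hyK m (hm (mem_insert_of_mem _ (mem_range_self m)))

/-- A space in which the complements of two distinct points are hemicompact is hemicompact. -/
theorem hemicompactSpace_of_compl_singleton [T2Space X]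
    (h : ∀ x : X, ∃ K : ℕ → Set X, (∀ n, IsCompact (K n)) ∧
      ∀ L : Set X, IsCompact L → x ∉ L → ∃ n, L ⊆ K n) : HemicompactSpace X := by
  rcases subsingleton_or_nontrivial X with hX | ⟨x, y, hxy⟩
  · exact ⟨fun _ => univ, fun _ => subsingleton_univ.isCompact, fun L _ => ⟨0, subset_univ L⟩⟩
  obtain ⟨K, hK, hKsub⟩ := h x
  obtain ⟨K', hK', hKsub'⟩ := h y
  obtain ⟨U, V, hU, hV, hxU, hyV, hUV⟩ := t2_separation hxy
  refine ⟨fun n => K n.unpair.1 ∪ K' n.unpair.2, fun n => (hK _).union (hK' _), fun L hL => ?_⟩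
  -- Since `U` and `V` are disjoint, `L \ U` and `L \ V` cover `L`, and each misses one of the two
  -- points.
  obtain ⟨m, hm⟩ := hKsub (L \ U) (hL.diff hU) fun hx => hx.2 hxU
  obtain ⟨n, hn⟩ := hKsub' (L \ V) (hL.diff hV) fun hy => hy.2 hyV
  refine ⟨Nat.pair m n, fun z hz => ?_⟩
  simp only [Nat.unpair_pair]
  by_cases hzU : z ∈ U
  · exact Or.inr (hn ⟨hz, disjoint_left.1 hUV hzU⟩)
  · exact Or.inl (hm ⟨hz, hzU⟩)

end Hemicompact

/-- A locally compact, σ-compact Hausdorff space whose compact subsets are metrizable is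
metrizable. -/
theorem metrizableSpace_of_isCompact_metrizableSpace {X : Type*} [TopologicalSpace X] [T2Space X]
    [LocallyCompactSpace X] [SigmaCompactSpace X]
    (h : ∀ K : Set X, IsCompact K → TopologicalSpace.MetrizableSpace K) :
    TopologicalSpace.MetrizableSpace X := by
  let E := CompactExhaustion.choice X
  have hsc : ∀ n, SecondCountableTopology (interior (E n)) := fun n => by
    have := h (E n) (E.isCompact n)
    have := isCompact_iff_compactSpace.1 (E.isCompact n)
    let := TopologicalSpace.metrizableSpaceMetric (E n)
    have : SecondCountableTopology (E n) := inferInstance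
    exact (IsEmbedding.inclusion (interior_subset (s := E n))).secondCountableTopology
  have : SecondCountableTopology X := by
    refine TopologicalSpace.secondCountableTopology_of_countable_cover
      (U := fun n => interior (E n)) (fun n => isOpen_interior)
      (eq_univ_of_forall fun x => ?_)
    exact mem_iUnion.2 ⟨E.find x + 1, E.subset_interior_succ _ (E.mem_find x)⟩
  exact TopologicalSpace.metrizableSpace_of_t3_secondCountable X

/-! ### The Fell topology -/

namespace CL

variable {X : Type*} [TopologicalSpace X]

theorem isOpen_hit {U : Set X} (hU : IsOpen U) : IsOpen (hit U) := by
  rcases U.eq_empty_or_nonempty with rfl | hne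
  · simp [hit]
  · exact TopologicalSpace.isOpen_generateFrom_of_mem (Or.inl ⟨U, hU, hne, rfl⟩)

theorem isOpen_inside_compl {K : Set X} (hK : IsCompact K) : IsOpen (inside Kᶜ) := by
  -- The subbase omits `K = X`, but there the set is empty because points of `CL X` are nonempty.
  by_cases hne : K = univ
  · have : inside Kᶜ = ∅ := eq_empty_of_forall_notMem fun A hA => by
      obtain ⟨x, hx⟩ := A.nonempty
      exact hA hx (hne ▸ mem_univ x)
    simp [this]
  · exact TopologicalSpace.isOpen_generateFrom_of_mem (Or.inr ⟨K, hK, hne, rfl⟩)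

theorem compl_hit (U : Set X) : (hit U)ᶜ = inside Uᶜ := by
  ext A
  simp [hit, inside, not_nonempty_iff_eq_empty, subset_compl_iff_disjoint_right,
    disjoint_iff_inter_eq_empty]

theorem continuous_iff {Z : Type*} [TopologicalSpace Z] {f : Z → CL X} :
    Continuous f ↔ (∀ U : Set X, IsOpen U → IsOpen (f ⁻¹' hit U)) ∧
      ∀ K : Set X, IsCompact K → IsOpen (f ⁻¹' inside Kᶜ) := by
  refine ⟨fun hf => ⟨fun U hU => (isOpen_hit hU).preimage hf,
    fun K hK => (isOpen_inside_compl hK).preimage hf⟩, fun h => continuous_generateFrom_iff.2 ?_⟩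
  rintro _ (⟨U, hU, -, rfl⟩ | ⟨K, hK, -, rfl⟩)
  exacts [h.1 U hU, h.2 K hK]

/-! ### Sets with at most two points -/

section Pairs

variable [T2Space X]

/-- The closed set `{x, y}` as a point of `ℱ₂(X)`. -/
def pair (x y : X) : finitesLE X 2 :=
  ⟨⟨{x, y}, insert_nonempty _ _, (toFinite {x, y}).isClosed⟩, by
    change ({x, y} : Set X).encard ≤ 2
    grw [encard_insert_le, encard_singleton]
    norm_num⟩

theorem continuous_pair : Continuous fun p : X × X => pair p.1 p.2 := by
  refine Continuous.subtype_mk (continuous_iff.2 ⟨fun U hU => ?_, fun K hK => ?_⟩) _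
  · convert (hU.preimage continuous_fst).union (hU.preimage (continuous_snd (X := X))) using 1
    ext p
    simp [hit, Set.Nonempty, or_and_right, exists_or]
  · have hU := hK.isClosed.isOpen_compl
    convert (hU.preimage continuous_fst).inter (hU.preimage (continuous_snd (X := X))) using 1
    ext p
    simp [inside, insert_subset_iff]

theorem eq_of_pair_eq_pair_self {x y z : X} (h : pair x y = pair z z) : x = y := by
  have h' : ({x, y} : Set X) = {z, z} := congrArg (fun A : finitesLE X 2 => A.1.carrier) h
  have hx : x ∈ ({z, z} : Set X) := h' ▸ mem_insert x _
  have hy : y ∈ ({z, z} : Set X) := h' ▸ mem_insert_of_mem x rfl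
  simp only [pair_eq_singleton, mem_singleton_iff] at hx hy
  rw [hx, hy]

theorem isEmbedding_pair_self : IsEmbedding fun x : X => pair x x := by
  refine ⟨⟨le_antisymm (continuous_pair.comp (continuous_id.prodMk continuous_id)).le_induced
    fun U hU => ?_⟩, fun x y h => ?_⟩
  · refine ⟨Subtype.val ⁻¹' hit U, (isOpen_hit hU).preimage continuous_subtype_val, ?_⟩
    ext x
    simp [hit, pair]
  · have h' : ({x, x} : Set X) = {y, y} := congrArg (fun A : finitesLE X 2 => A.1.carrier) h
    simpa using h'

/-- A Fell neighbourhood of `{x}` contains all `{x, y}` with `y` outside some compact set that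
misses `x`. -/
theorem exists_isCompact_forall_pair_mem {S : Set (CL X)} (hS : IsOpen S) {x : X}
    (hx : (pair x x).1 ∈ S) :
    ∃ K : Set X, IsCompact K ∧ ∀ y ∉ K, (pair x y).1 ∈ S := by
  -- The point `x` alone witnesses a hit set, so only the miss sets restrict `y`.
  induction hS with
  | basic S hS =>
    rcases hS with ⟨U, -, -, rfl⟩ | ⟨K, hK, -, rfl⟩
    · have hxU : x ∈ U := by simpa [hit, pair] using hx
      exact ⟨∅, isCompact_empty, fun y _ => ⟨x, mem_insert x _, hxU⟩⟩
    · have hxK : x ∉ K := by simpa [inside, pair] using hx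
      exact ⟨K, hK, fun y hy => by simp [inside, pair, insert_subset_iff, hxK, hy]⟩
  | univ => exact ⟨∅, isCompact_empty, fun _ _ => mem_univ _⟩
  | inter S T _ _ ihS ihT =>
    obtain ⟨K, hK, hKS⟩ := ihS hx.1
    obtain ⟨L, hL, hLT⟩ := ihT hx.2
    refine ⟨K ∪ L, hK.union hL, fun y hy => ?_⟩
    rw [mem_union, not_or] at hy
    exact ⟨hKS y hy.1, hLT y hy.2⟩
  | sUnion 𝒮 _ ih =>
    obtain ⟨S, hS, hxS⟩ := hx
    obtain ⟨K, hK, hKS⟩ := ih S hS hxS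
    exact ⟨K, hK, fun y hy => ⟨S, hS, hKS y hy⟩⟩

/-- If `L` misses `x`, some basic `V n` at `{x}` consists of sets missing `L`; a point `y ∈ L`
outside `K n` would put `{x, y}` in `V n`. -/
theorem hemicompactSpace_of_firstCountable_finitesLE_two
    [FirstCountableTopology (finitesLE X 2)] : HemicompactSpace X := by
  refine hemicompactSpace_of_compl_singleton fun x => ?_
  obtain ⟨V, hV⟩ := (𝓝 (pair x x)).exists_antitone_basis
  have hex : ∀ n, ∃ K : Set X, IsCompact K ∧ ∀ y ∉ K, pair x y ∈ V n := fun n => by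
    obtain ⟨T, hT, hTV⟩ := (mem_nhds_subtype _ _ _).1 (hV.mem n)
    obtain ⟨S, hST, hS, hxS⟩ := mem_nhds_iff.1 hT
    obtain ⟨K, hK, hKS⟩ := exists_isCompact_forall_pair_mem hS hxS
    exact ⟨K, hK, fun y hy => hTV (hST (hKS y hy))⟩
  choose K hK hKV using hex
  refine ⟨K, hK, fun L hL hxL => ?_⟩
  have hmem : Subtype.val ⁻¹' inside Lᶜ ∈ 𝓝 (pair x x) :=
    ((isOpen_inside_compl hL).preimage continuous_subtype_val).mem_nhds
      (by simpa [inside, pair] using hxL)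
  obtain ⟨n, hn⟩ := hV.mem_iff.1 hmem
  refine ⟨n, fun y hyL => ?_⟩
  by_contra hy
  exact hn (hKV n y hy) (mem_insert_of_mem x rfl) hyL

theorem isGδ_diagonal_of_quasiMetrizableSpace_finitesLE_two
    (h : QuasiMetrizableSpace (finitesLE X 2)) {K : Set X} (hK : IsCompact K) :
    IsGδ (diagonal K) := by
  have hG : IsGδ ((fun x : X => pair x x) '' K) :=
    (hK.image isEmbedding_pair_self.continuous).isGδ_of_quasiMetrizableSpace h
  have hc : Continuous fun p : K × K => pair (p.1 : X) (p.2 : X) :=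
    continuous_pair.comp (continuous_subtype_val.prodMap continuous_subtype_val)
  convert hG.preimage hc using 1
  ext ⟨x, y⟩
  simp only [mem_diagonal_iff, mem_preimage, mem_image]
  constructor
  · rintro rfl
    exact ⟨x, x.2, rfl⟩
  · rintro ⟨z, -, hz⟩
    exact Subtype.ext (eq_of_pair_eq_pair_self hz.symm)

theorem hemicompactSpace_and_metrizableSpace_of_finitesLE_two
    (h : QuasiMetrizableSpace (finitesLE X 2)) :
    HemicompactSpace X ∧ TopologicalSpace.MetrizableSpace X := by
  have := h.firstCountableTopology
  have hX : HemicompactSpace X := hemicompactSpace_of_firstCountable_finitesLE_two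
  have : FirstCountableTopology X :=
    (isEmbedding_pair_self (X := X)).toIsInducing.firstCountableTopology
  have := hX.locallyCompactSpace
  have := hX.sigmaCompactSpace
  refine ⟨hX, metrizableSpace_of_isCompact_metrizableSpace fun K hK => ?_⟩
  have := isCompact_iff_compactSpace.1 hK
  exact metrizableSpace_of_isGδ_diagonal
    (isGδ_diagonal_of_quasiMetrizableSpace_finitesLE_two h hK)

end Pairs

/-- If `x ∈ C \ D`, the open set `hit Dᶜ` contains `C` but not `D`. -/
theorem t0Space : T0Space (CL X) := by
  refine ⟨fun A B hAB => CL.ext ?_⟩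
  have key : ∀ C D : CL X, Inseparable C D → C.carrier ⊆ D.carrier := fun C D h x hx => by
    by_contra hxD
    obtain ⟨y, hy, hyD⟩ := (h.mem_open_iff (isOpen_hit D.isClosed.isOpen_compl)).1 ⟨x, hx, hxD⟩
    exact hyD hy
  exact (key A B hAB).antisymm (key B A hAB.symm)

/-! ### Hyperspaces of locally compact spaces -/

section LocallyCompact

variable [LocallyCompactSpace X]

/-- It suffices to separate points from complements of subbasic sets. In both cases local
compactness interpolates a compact `L`, and `hit (interior L)` and `inside Lᶜ` are disjoint and
open. -/
theorem regularSpace : RegularSpace (CL X) := by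
  refine (regularSpace_generateFrom rfl).2 ?_
  rintro _ (⟨U, hU, -, rfl⟩ | ⟨K, hK, -, rfl⟩) A hA
  · obtain ⟨x, hxA, hxU⟩ := hA
    obtain ⟨L, hL, hxL, hLU⟩ := exists_compact_subset hU hxU
    rw [compl_hit]
    refine disjoint_of_disjoint_of_mem (s := inside Lᶜ) (t := hit (interior L)) ?_
      ((isOpen_inside_compl hL).mem_nhdsSet.2 fun B hB => hB.trans (compl_subset_compl.2 hLU))
      ((isOpen_hit isOpen_interior).mem_nhds ⟨x, hxA, hxL⟩)
    exact disjoint_left.2 fun B hB ⟨y, hyB, hyL⟩ => hB hyB (interior_subset hyL)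
  · obtain ⟨L, hL, hKL, hLA⟩ := exists_compact_between hK A.isClosed.isOpen_compl
      (subset_compl_comm.1 hA)
    rw [← compl_hit, compl_compl]
    refine disjoint_of_disjoint_of_mem (s := hit (interior L)) (t := inside Lᶜ) ?_
      ((isOpen_hit isOpen_interior).mem_nhdsSet.2 fun B hB => hB.mono (inter_subset_inter_right _ hKL))
      ((isOpen_inside_compl hL).mem_nhds (subset_compl_comm.1 hLA))
    exact disjoint_right.2 fun B hB ⟨y, hyB, hyL⟩ => hB hyB (interior_subset hyL)

/-- A countable subbase suffices: hit sets of basic open sets, and miss sets of compact finite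
unions of closures of basic open sets. A compact set disjoint from `A` is covered by such a union
still disjoint from `A`. -/
theorem secondCountableTopology [T2Space X] [SecondCountableTopology X] :
    SecondCountableTopology (CL X) := by
  let 𝓑 := TopologicalSpace.countableBasis X
  have h𝓑 := TopologicalSpace.isBasis_countableBasis X
  let 𝓒 : Set (Set X) := {C | ∃ F : Set (Set X), (F.Finite ∧ F ⊆ 𝓑) ∧ ⋃ U ∈ F, closure U = C}
  have h𝓒 : 𝓒.Countable :=
    (countable_ofPred_finite_subset (TopologicalSpace.countable_countableBasis X)).image
      fun F => ⋃ U ∈ F, closure U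
  refine ⟨⟨hit '' 𝓑 ∪ (fun C => inside Cᶜ) '' {C ∈ 𝓒 | IsCompact C},
    ((TopologicalSpace.countable_countableBasis X).image _).union
      ((h𝓒.mono (sep_subset _ _)).image _), le_antisymm ?_ ?_⟩⟩
  · refine le_generateFrom ?_
    rintro _ (⟨U, hU, rfl⟩ | ⟨C, ⟨-, hC⟩, rfl⟩)
    exacts [isOpen_hit (h𝓑.isOpen hU), isOpen_inside_compl hC]
  · refine le_generateFrom ?_
    rintro _ (⟨U, hU, -, rfl⟩ | ⟨K, hK, -, rfl⟩)
    · obtain ⟨S, hS, rfl⟩ := h𝓑.open_eq_sUnion hU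
      have : hit (⋃₀ S) = ⋃ V ∈ S, hit V := by
        ext A
        simp [hit, sUnion_eq_biUnion, inter_iUnion₂]
      rw [this]
      -- The explicit `(_)` selects the topology generated by the countable family instead of the
      -- Fell instance.
      refine @isOpen_biUnion _ _ (_) _ _ fun V hV => ?_
      exact TopologicalSpace.isOpen_generateFrom_of_mem (Or.inl (mem_image_of_mem _ (hS hV)))
    · refine (@isOpen_iff_forall_mem_open _ (_) _).2 fun A hA => ?_
      have hex : ∀ x ∈ K, ∃ U ∈ 𝓑, x ∈ U ∧ IsCompact (closure U) ∧ closure U ⊆ A.carrierᶜ := by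
        intro x hx
        obtain ⟨L, hL, hxL, hLA⟩ :=
          exists_compact_subset A.isClosed.isOpen_compl (subset_compl_comm.1 hA hx)
        obtain ⟨U, hU, hxU, hUL⟩ := h𝓑.exists_subset_of_mem_open hxL isOpen_interior
        have hcl : closure U ⊆ L := closure_minimal (hUL.trans interior_subset) hL.isClosed
        exact ⟨U, hU, hxU, hL.of_isClosed_subset isClosed_closure hcl, hcl.trans hLA⟩
      choose! U hU𝓑 hxU hUc hUA using hex
      obtain ⟨t, htK, htc⟩ := hK.elim_nhds_subcover U
        fun x hx => (h𝓑.isOpen (hU𝓑 x hx)).mem_nhds (hxU x hx)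
      have hC𝓒 : (⋃ V ∈ U '' (t : Set X), closure V) ∈ 𝓒 :=
        ⟨U '' t, ⟨t.finite_toSet.image U, image_subset_iff.2 fun x hx => hU𝓑 x (htK x hx)⟩, rfl⟩
      have hCc : IsCompact (⋃ V ∈ U '' (t : Set X), closure V) :=
        (t.finite_toSet.image U).isCompact_biUnion
          (forall_mem_image.2 fun x hx => hUc x (htK x hx))
      have hKC : K ⊆ ⋃ V ∈ U '' (t : Set X), closure V := by
        rw [biUnion_image]
        exact htc.trans (iUnion₂_mono fun x _ => subset_closure)
      refine ⟨_, fun B hB => hB.trans (compl_subset_compl.2 hKC),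
        TopologicalSpace.isOpen_generateFrom_of_mem
          (Or.inr (mem_image_of_mem (fun C => inside Cᶜ) ⟨hC𝓒, hCc⟩)), ?_⟩
      refine subset_compl_comm.1 (iUnion₂_subset ?_)
      exact forall_mem_image.2 fun x hx => hUA x (htK x hx)

end LocallyCompact

theorem metrizableSpace_of_hemicompactSpace [TopologicalSpace.MetrizableSpace X]
    (h : HemicompactSpace X) : TopologicalSpace.MetrizableSpace (CL X) := by
  let := TopologicalSpace.metrizableSpaceMetric X
  have := h.locallyCompactSpace
  have := h.sigmaCompactSpace
  have : SecondCountableTopology X := EMetric.secondCountable_of_sigmaCompact X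
  have := t0Space (X := X)
  have := regularSpace (X := X)
  have := secondCountableTopology (X := X)
  exact TopologicalSpace.metrizableSpace_of_t3_secondCountable (CL X)

end CL

theorem mainTheorem2 (X : Type*) [TopologicalSpace X] [T2Space X] :
    List.TFAE
      [TopologicalSpace.MetrizableSpace (CL X),
        QuasiMetrizableSpace (CL X),
        QuasiMetrizableSpace (CL.compacts X),
        QuasiMetrizableSpace (CL.finites X),
        QuasiMetrizableSpace (CL.finitesLE X 2),
        HemicompactSpace X ∧ TopologicalSpace.MetrizableSpace X] := by
  tfae_have 1 → 2 := fun _ => TopologicalSpace.MetrizableSpace.quasiMetrizableSpace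
  tfae_have 2 → 3 := IsEmbedding.subtypeVal.quasiMetrizableSpace
  tfae_have 3 → 4 :=
    (IsEmbedding.inclusion fun _ hA => Set.Finite.isCompact hA).quasiMetrizableSpace
  tfae_have 4 → 5 :=
    (IsEmbedding.inclusion fun _ hA => finite_of_encard_le_coe hA).quasiMetrizableSpace
  tfae_have 5 → 6 := CL.hemicompactSpace_and_metrizableSpace_of_finitesLE_two
  tfae_have 6 → 1 := fun ⟨h, _⟩ => CL.metrizableSpace_of_hemicompactSpace h
  tfae_finish
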